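/- Let $E=(E^0,E^1,r,s)$ be a directed graph (no finiteness or countability is assumed). A path of length $n\ge 1$ is a sequence $\mu=\mu_1\cdots\mu_n$ of edges with $r(\mu_{i+1})=s(\mu_i)$ for $1\le i<n$; put $|\mu|=n$, $r(\mu)=r(\mu_1)$, $s(\mu)=s(\mu_n)$. Vertices are the paths of length $0$, with $r(v)=s(v)=v$. Let $C^*(E)$ be the universal C*-algebra generated by mutually orthogonal projections $p_v$ ($v\in E^0$) and partial isometries $s_e$ ($e\in E^1$) with mutually orthogonal ranges such that $s_e^*s_e=p_{s(e)}$, $s_es_e^*\le p_{r(e)}$, and $p_v=\sum_{r(e)=v}s_es_e^*$ whenever $0<|r^{-1}(v)|<\infty$. Write $s_\mu=s_{\mu_1}\cdots s_{\mu_n}$ and $s_v=p_v$. Let $\gamma$ be the gauge action of the circle $\mathbb T$, $\gamma_z(s_e)=zs_e$, $\gamma_z(p_v)=p_v$, let $C^*(E)^\gamma$ (the core) be its fixed-point algebra, and let $\Phi:C^*(E)\to C^*(E)^\gamma$, $\Phi(a)=\int_{\mathbb T}\gamma_z(a)\,dz$ (normalized Haar measure), be the conditional expectation; it satisfies $\Phi(s_\mu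 s_\nu^*)=[\,|\mu|=|\nu|\,]\,s_\mu s_\nu^*$. Let $c:E^1\to(0,\infty)$, extended to paths by $c(v)=1$ for $v\in E^0$ and $c(\mu)=c(\mu_1)\cdots c(\mu_n)$, and let $\sigma=\sigma^c$ be the action of $\mathbb R$ on $C^*(E)$ with $\sigma_t(s_e)=c(e)^{it}s_e$ and $\sigma_t(p_v)=p_v$. Let $\beta>0$. A state is a positive linear functional of norm $1$. A $(\sigma,\beta)$-KMS state is a state $\varphi$ on $C^*(E)$ with $\varphi(xy)=\varphi(y\,\sigma_{i\beta}(x))$ for all $x,y\in C^*(E)$ that are analytic for $\sigma$, i.e. for which $t\mapsto\sigma_t(x)$ and $t\mapsto\sigma_t(y)$ extend to entire functions $\zeta\mapsto\sigma_\zeta(x)$, $\zeta\mapsto\sigma_\zeta(y)$. Assume that $c(\mu)\ne1$ for every path $\mu$ with $|\mu|>0$. (i) If $\varphi$ is a $(\sigma,\beta)$-KMS state on $C^*(E)$, then its restriction $\omega=\varphi|_{C^*(E)^\gamma}$ is a state on $C^*(E)^\gamma$ satisfying $$\omega(s_\mu s_\nu^*)=[\mu=\nu]\,c(\mu)^{-\beta}\,\omega(p_{s(\mu)})\quad\text{for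 all paths }\mu,\nu\text{ with }|\mu|=|\nu|,\ s(\mu)=s(\nu).\qquad(*)$$ (ii) If $\omega$ is a state on $C^*(E)^\gamma$ satisfying $(*)$, then $\omega\circ\Phi$ is a $(\sigma,\beta)$-KMS state on $C^*(E)$. (iii) The maps $\varphi\mapsto\varphi|_{C^*(E)^\gamma}$ and $\omega\mapsto\omega\circ\Phi$ are mutually inverse bijections between the set of $(\sigma,\beta)$-KMS states on $C^*(E)$ and the set of states on $C^*(E)^\gamma$ satisfying $(*)$. Both sets are convex, and both maps preserve convex combinations. -/

import Mathlib

open scoped ENNReal ComplexOrder CStarAlgebra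

universe u v

namespace GraphAlg

/-! ### Directed graphs and paths -/

/-- A directed graph with vertex set `V` and edge set `Ed` (multiple edges and loops allowed). -/
structure DirGraph (V : Type u) (Ed : Type v) where
  /-- the range of an edge -/
  rng : Ed → V
  /-- the source of an edge -/
  src : Ed → V

variable {V : Type u} {Ed : Type v}

namespace DirGraph

/-- `E.Chain w l`: the list of edges `l = μ₁ ⋯ μₙ` satisfies `r(μ₁) = w` (if `n ≥ 1`) and
`r(μᵢ₊₁) = s(μᵢ)`. -/
def Chain (E : DirGraph V Ed) : V → List Ed → Prop
  | _, [] => True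
  | w, e :: l => E.rng e = w ∧ E.Chain (E.src e) l

/-- The source of the path with range `w` and edges `l`. -/
def chainSrc (E : DirGraph V Ed) : V → List Ed → V
  | w, [] => w
  | _, e :: l => E.chainSrc (E.src e) l

/-- A finite path `μ = μ₁ ⋯ μₙ`, recorded by its range `r(μ)` and its list of edges. A path
without edges is a vertex. -/
@[ext]
structure Path (E : DirGraph V Ed) where
  /-- the range of the path -/
  rng : V
  /-- the edges of the path -/
  edges : List Ed
  chain : E.Chain rng edges

variable {E : DirGraph V Ed}

/-- The length `|μ|`. -/
def Path.length (μ : E.Path) : ℕ := μ.edges.length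

/-- The source `s(μ)`. -/
def Path.src (μ : E.Path) : V := E.chainSrc μ.rng μ.edges

/-- The extension `c(μ) = c(μ₁) ⋯ c(μₙ)` of a function on edges to paths (`c(v) = 1` for a
vertex `v`). -/
noncomputable def Path.weight (c : Ed → ℝ) (μ : E.Path) : ℝ := (μ.edges.map c).prod

end DirGraph

/-! ### Cuntz-Krieger families and the graph C*-algebra -/

/-- `(p, s)` is a Cuntz-Krieger family for `E` in the C*-algebra `B`: mutually orthogonal
projections `p v` and partial isometries `s e` with mutually orthogonal ranges such that
`s_e^* s_e = p_{s(e)}`, `s_e s_e^* ≤ p_{r(e)}`, and `p_v = ∑_{r(e) = v} s_e s_e^*` whenever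
`0 < |r⁻¹(v)| < ∞`. For projections `q ≤ p` means `p * q = q`. -/
structure IsCKFamily (E : DirGraph V Ed) {B : Type*} [NonUnitalCStarAlgebra B]
    (p : V → B) (s : Ed → B) : Prop where
  proj : ∀ v, IsStarProjection (p v)
  proj_orthogonal : ∀ v w, v ≠ w → p v * p w = 0
  partial_isometry : ∀ e, s e * star (s e) * s e = s e
  range_orthogonal : ∀ e f, e ≠ f → (s e * star (s e)) * (s f * star (s f)) = 0
  star_mul_self : ∀ e, star (s e) * s e = p (E.src e)
  range_le : ∀ e, p (E.rng e) * (s e * star (s e)) = s e * star (s e)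
  sum_range : ∀ v, ∀ h : {e | E.rng e = v}.Finite, {e | E.rng e = v}.Nonempty →
    p v = ∑ e ∈ h.toFinset, s e * star (s e)

/-- A C*-algebra together with a Cuntz-Krieger family for `E` in it. -/
structure CKRep (E : DirGraph V Ed) : Type (max u v + 1) where
  /-- the C*-algebra -/
  B : Type (max u v)
  [inst : NonUnitalCStarAlgebra B]
  /-- the projections -/
  p : V → B
  /-- the partial isometries -/
  s : Ed → B
  isCK : IsCKFamily E p s

attribute [instance] CKRep.inst

variable (E : DirGraph V Ed)

/-- The C*-product of all C*-algebras that carry a Cuntz-Krieger family. -/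
abbrev Ambient : Type (max u v + 1) := lp (fun i : CKRep E => i.B) ∞

variable {E}

theorem IsCKFamily.norm_p_le {B : Type*} [NonUnitalCStarAlgebra B] {p : V → B} {s : Ed → B}
    (h : IsCKFamily E p s) (v : V) : ‖p v‖ ≤ 1 := by
  have h1 : ‖p v‖ * ‖p v‖ = ‖p v‖ := by
    conv_rhs => rw [← (h.proj v).isIdempotentElem.eq]
    conv_rhs => enter [1, 1]; rw [← (h.proj v).isSelfAdjoint.star_eq]
    rw [CStarRing.norm_star_mul_self]
  nlinarith [norm_nonneg (p v)]

theorem IsCKFamily.norm_s_le {B : Type*} [NonUnitalCStarAlgebra B] {p : V → B} {s : Ed → B}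
    (h : IsCKFamily E p s) (e : Ed) : ‖s e‖ ≤ 1 := by
  have h1 : ‖s e‖ * ‖s e‖ ≤ 1 := by
    rw [← CStarRing.norm_star_mul_self, h.star_mul_self]
    exact h.norm_p_le _
  nlinarith [norm_nonneg (s e)]

variable (E)

/-- The family of all the `p_v`. -/
def ambientP (v : V) : Ambient E :=
  ⟨fun i => i.p v, memℓp_infty ⟨1, by rintro _ ⟨i, rfl⟩; exact i.isCK.norm_p_le v⟩⟩

/-- The family of all the `s_e`. -/
def ambientS (e : Ed) : Ambient E :=
  ⟨fun i => i.s e, memℓp_infty ⟨1, by rintro _ ⟨i, rfl⟩; exact i.isCK.norm_s_le e⟩⟩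

/-- The C*-subalgebra of the product generated by the universal `p_v` and `s_e`. -/
noncomputable def universalSubalgebra : NonUnitalStarSubalgebra ℂ (Ambient E) :=
  (NonUnitalStarAlgebra.adjoin ℂ
    (Set.range (ambientP E) ∪ Set.range (ambientS E))).topologicalClosure

/-- The graph C*-algebra `C*(E)`, the universal C*-algebra generated by a Cuntz-Krieger family:
the C*-algebra generated by `p_v = (p_v^i)_i` and `s_e = (s_e^i)_i`, where `i` runs through all
Cuntz-Krieger families in C*-algebras. (A C*-algebra generated by a Cuntz-Krieger family for `E`
has at most `(ℵ₀ + |V| + |Ed|) ^ ℵ₀` elements, hence a copy in the universe `max u v`.) Its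
universal property is `existsUnique_lift` below. -/
def GraphCStar : Type (max u v + 1) := universalSubalgebra E

noncomputable instance : NonUnitalCStarAlgebra (GraphCStar E) :=
  NonUnitalStarSubalgebra.nonUnitalCStarAlgebra (universalSubalgebra E)
    (h_closed := NonUnitalStarSubalgebra.isClosed_topologicalClosure _)

/-- The inclusion of `C*(E)` into the product. -/
noncomputable def incl : GraphCStar E →⋆ₙₐ[ℂ] Ambient E :=
  NonUnitalStarSubalgebraClass.subtype (universalSubalgebra E)

theorem incl_injective : Function.Injective (incl E) := Subtype.val_injective

/-- The generating projections `p_v` of `C*(E)`. -/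
noncomputable def p (v : V) : GraphCStar E :=
  (⟨ambientP E v, NonUnitalStarSubalgebra.le_topologicalClosure _
    (NonUnitalStarAlgebra.subset_adjoin ℂ _ (Or.inl ⟨v, rfl⟩))⟩ : universalSubalgebra E)

/-- The generating partial isometries `s_e` of `C*(E)`. -/
noncomputable def s (e : Ed) : GraphCStar E :=
  (⟨ambientS E e, NonUnitalStarSubalgebra.le_topologicalClosure _
    (NonUnitalStarAlgebra.subset_adjoin ℂ _ (Or.inr ⟨e, rfl⟩))⟩ : universalSubalgebra E)

/-- The coordinate of an element of `C*(E)` at a Cuntz-Krieger family. -/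
noncomputable def coord (i : CKRep E) : GraphCStar E →⋆ₙₐ[ℂ] i.B where
  toFun a := (incl E a : Ambient E) i
  map_smul' _ _ := rfl
  map_zero' := rfl
  map_add' _ _ := rfl
  map_mul' _ _ := rfl
  map_star' _ := rfl

theorem coord_ext {a b : GraphCStar E} (h : ∀ i, coord E i a = coord E i b) : a = b :=
  incl_injective E (lp.ext (funext h))

/-- The generators of `C*(E)` form a Cuntz-Krieger family. -/
theorem isCKFamily : IsCKFamily E (p E) (s E) where
  proj v := ⟨coord_ext E fun i => (i.isCK.proj v).isIdempotentElem,
    coord_ext E fun i => (i.isCK.proj v).isSelfAdjoint⟩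
  proj_orthogonal v w h := coord_ext E fun i => i.isCK.proj_orthogonal v w h
  partial_isometry e := coord_ext E fun i => i.isCK.partial_isometry e
  range_orthogonal e f h := coord_ext E fun i => i.isCK.range_orthogonal e f h
  star_mul_self e := coord_ext E fun i => i.isCK.star_mul_self e
  range_le e := coord_ext E fun i => i.isCK.range_le e
  sum_range v h hn := coord_ext E fun i => by
    rw [map_sum]
    exact i.isCK.sum_range v h hn

/-- `C*(E)` is generated by the `p_v` and `s_e`: a closed *-subalgebra containing them is
everything. -/
theorem mem_of_closed (T : NonUnitalStarSubalgebra ℂ (GraphCStar E))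
    (hT : IsClosed (T : Set (GraphCStar E))) (hp : ∀ v, p E v ∈ T) (hs : ∀ e, s E e ∈ T)
    (a : GraphCStar E) : a ∈ T := by
  have hiso : Topology.IsClosedEmbedding (incl E) :=
    (NonUnitalStarSubalgebra.isClosed_topologicalClosure _).isClosedEmbedding_subtypeVal
  have h1 : universalSubalgebra E ≤ T.map (incl E) := by
    refine NonUnitalStarSubalgebra.topologicalClosure_minimal _ ?_ ?_
    · refine NonUnitalStarAlgebra.adjoin_le ?_
      rintro _ (⟨v, rfl⟩ | ⟨e, rfl⟩)
      · exact ⟨p E v, hp v, rfl⟩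
      · exact ⟨s E e, hs e, rfl⟩
    · exact hiso.isClosedMap _ hT
  obtain ⟨b, hb, hba⟩ := h1 (show incl E a ∈ universalSubalgebra E from Subtype.property _)
  exact incl_injective E hba ▸ hb

/-- Two *-homomorphisms on `C*(E)` that agree on the generators are equal. -/
theorem hom_ext {B : Type*} [NonUnitalCStarAlgebra B] {f g : GraphCStar E →⋆ₙₐ[ℂ] B}
    (hp : ∀ v, f (p E v) = g (p E v)) (hs : ∀ e, f (s E e) = g (s E e)) : f = g := by
  ext a
  refine mem_of_closed E (NonUnitalStarAlgHom.equalizer f g) ?_ hp hs a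
  exact isClosed_eq (map_continuous f) (map_continuous g)

/-- The universal property of `C*(E)`. -/
theorem existsUnique_lift {B : Type (max u v)} [NonUnitalCStarAlgebra B] {q : V → B} {t : Ed → B}
    (h : IsCKFamily E q t) :
    ∃! f : GraphCStar E →⋆ₙₐ[ℂ] B, (∀ v, f (p E v) = q v) ∧ ∀ e, f (s E e) = t e :=
  ⟨coord E ⟨B, q, t, h⟩, ⟨fun _ => rfl, fun _ => rfl⟩, fun _ hf =>
    hom_ext E (fun v => hf.1 v) (fun e => hf.2 e)⟩

/-! ### Gauge-type actions -/

variable {E}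

theorem IsCKFamily.twist {B : Type*} [NonUnitalCStarAlgebra B] {p : V → B} {s : Ed → B}
    (h : IsCKFamily E p s) (z : Ed → Circle) : IsCKFamily E p fun e => (z e : ℂ) • s e := by
  have hz : ∀ e, (z e : ℂ) * star (z e : ℂ) = 1 := fun e => by
    rw [Complex.star_def, Complex.mul_conj, Complex.normSq_eq_norm_sq, Circle.norm_coe]; simp
  have hz' : ∀ e, star (z e : ℂ) * (z e : ℂ) = 1 := fun e => by rw [mul_comm, hz]
  have h1 : ∀ e, ((z e : ℂ) • s e) * star ((z e : ℂ) • s e) = s e * star (s e) := fun e => by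
    rw [star_smul, smul_mul_smul_comm, hz, one_smul]
  have h2 : ∀ e, star ((z e : ℂ) • s e) * ((z e : ℂ) • s e) = star (s e) * s e := fun e => by
    rw [star_smul, smul_mul_smul_comm, hz', one_smul]
  refine ⟨h.proj, h.proj_orthogonal, ?_, ?_, ?_, ?_, ?_⟩
  · intro e
    rw [h1, mul_smul_comm, h.partial_isometry]
  · intro e f hef
    rw [h1, h1, h.range_orthogonal e f hef]
  · intro e
    rw [h2, h.star_mul_self]
  · intro e
    rw [h1, h.range_le]
  · intro v hf hn
    simp only [h1]
    exact h.sum_range v hf hn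

/-- Multiplying the partial isometries of a family by complex numbers of modulus one. -/
def CKRep.twist (z : Ed → Circle) (i : CKRep E) : CKRep E where
  B := i.B
  p := i.p
  s := fun e => (z e : ℂ) • i.s e
  isCK := i.isCK.twist z

variable (E)

/-- The *-homomorphism of the product which reindexes along `CKRep.twist z`. -/
noncomputable def ambientTwist (z : Ed → Circle) : Ambient E →⋆ₙₐ[ℂ] Ambient E where
  toFun a := ⟨fun i => a (i.twist z), memℓp_infty ⟨‖a‖, by
    rintro _ ⟨i, rfl⟩; exact lp.norm_apply_le_norm ENNReal.top_ne_zero a (i.twist z)⟩⟩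
  map_smul' _ _ := rfl
  map_zero' := rfl
  map_add' _ _ := rfl
  map_mul' _ _ := rfl
  map_star' _ := rfl

theorem ambientTwist_mem (z : Ed → Circle) (a : GraphCStar E) :
    ambientTwist E z (incl E a) ∈ universalSubalgebra E := by
  have hcl : IsClosed (universalSubalgebra E : Set (Ambient E)) :=
    NonUnitalStarSubalgebra.isClosed_topologicalClosure _
  have hc : Continuous fun a => ambientTwist E z (incl E a) :=
    (map_continuous (ambientTwist E z)).comp (map_continuous (incl E))
  refine mem_of_closed E
    (NonUnitalStarSubalgebra.comap ((ambientTwist E z).comp (incl E)) (universalSubalgebra E))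
    (hcl.preimage hc) (fun v => ?_) (fun e => ?_) a
  · exact Subtype.property (p E v : universalSubalgebra E)
  · have : ambientTwist E z (incl E (s E e)) = (z e : ℂ) • incl E (s E e) := rfl
    show ambientTwist E z (incl E (s E e)) ∈ universalSubalgebra E
    rw [this]
    exact SMulMemClass.smul_mem _ (Subtype.property (s E e : universalSubalgebra E))

/-- The *-homomorphism of `C*(E)` with `p_v ↦ p_v` and `s_e ↦ z_e s_e`, for `|z_e| = 1`. -/
noncomputable def act (z : Ed → Circle) : GraphCStar E →⋆ₙₐ[ℂ] GraphCStar E where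
  toFun a := (⟨ambientTwist E z (incl E a), ambientTwist_mem E z a⟩ : universalSubalgebra E)
  map_smul' _ _ := rfl
  map_zero' := rfl
  map_add' _ _ := rfl
  map_mul' _ _ := rfl
  map_star' _ := rfl

@[simp] theorem act_p (z : Ed → Circle) (v : V) : act E z (p E v) = p E v := rfl

@[simp] theorem act_s (z : Ed → Circle) (e : Ed) : act E z (s E e) = (z e : ℂ) • s E e := rfl

theorem act_one (a : GraphCStar E) : act E 1 a = a := by
  have : act E 1 = NonUnitalStarAlgHom.id ℂ (GraphCStar E) :=
    hom_ext E (fun v => by simp) (fun e => by simp)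
  rw [this]; rfl

theorem act_mul (z w : Ed → Circle) (a : GraphCStar E) :
    act E (z * w) a = act E z (act E w a) := by
  have : act E (z * w) = (act E z).comp (act E w) :=
    hom_ext E (fun v => by simp) (fun e => by simp [smul_smul, mul_comm])
  rw [this]; rfl

theorem norm_act_le (z : Ed → Circle) (a : GraphCStar E) : ‖act E z a‖ ≤ ‖a‖ :=
  NonUnitalStarAlgHom.norm_apply_le (act E z) a

/-- The gauge action `γ` of the circle: `γ_z(s_e) = z s_e`, `γ_z(p_v) = p_v`. -/
noncomputable def gauge (z : Circle) : GraphCStar E →⋆ₙₐ[ℂ] GraphCStar E := act E fun _ => z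

/-- The generalized gauge action `σ^c` of the real line:
`σ_t(s_e) = c(e)^{it} s_e = exp(i t log c(e)) s_e`, `σ_t(p_v) = p_v`. -/
noncomputable def dynamics (c : Ed → ℝ) (t : ℝ) : GraphCStar E →⋆ₙₐ[ℂ] GraphCStar E :=
  act E fun e => Circle.exp (t * Real.log (c e))

theorem dynamics_p (c : Ed → ℝ) (t : ℝ) (v : V) : dynamics E c t (p E v) = p E v := rfl

theorem dynamics_s (c : Ed → ℝ) (t : ℝ) (e : Ed) (h : 0 < c e) :
    dynamics E c t (s E e) = ((c e : ℂ) ^ (Complex.I * t)) • s E e := by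
  rw [dynamics, act_s, Circle.coe_exp, Complex.cpow_def_of_ne_zero (by exact_mod_cast h.ne'),
    ← Complex.ofReal_log h.le]
  congr 2
  push_cast
  ring

/-! ### The core -/

/-- The core `C*(E)^γ`: the fixed-point algebra of the gauge action. -/
noncomputable def core : NonUnitalStarSubalgebra ℂ (GraphCStar E) where
  carrier := {a | ∀ z, gauge E z a = a}
  add_mem' ha hb z := by rw [map_add, ha z, hb z]
  zero_mem' z := map_zero _
  mul_mem' ha hb z := by rw [map_mul, ha z, hb z]
  smul_mem' k _ ha z := by rw [map_smul, ha z]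
  star_mem' ha z := by rw [map_star, ha z]

instance core_isClosed : IsClosed (core E : Set (GraphCStar E)) := by
  have : (core E : Set (GraphCStar E)) = ⋂ z, {a | gauge E z a = a} := by
    ext a
    rw [Set.mem_iInter]
    exact Iff.rfl
  rw [this]
  exact isClosed_iInter fun z => isClosed_eq (map_continuous (gauge E z)) continuous_id

theorem s_mul_p (e : Ed) : s E e * p E (E.src e) = s E e := by
  rw [← (isCKFamily E).star_mul_self, ← mul_assoc, (isCKFamily E).partial_isometry]

/-- `s_μ` for the path with range `w` and edges `l`. (For `n ≥ 1` this is
`s_{μ₁} ⋯ s_{μₙ} p_{s(μ)}`, which is `s_{μ₁} ⋯ s_{μₙ}` since `s_e p_{s(e)} = s_e`.) -/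
noncomputable def sChain : V → List Ed → GraphCStar E
  | w, [] => p E w
  | _, e :: l => s E e * sChain (E.src e) l

variable {E}

/-- `s_μ = s_{μ₁} ⋯ s_{μₙ}` for a path `μ = μ₁ ⋯ μₙ`, and `s_v = p_v` for a vertex `v`. -/
noncomputable def sPath (μ : E.Path) : GraphCStar E := sChain E μ.rng μ.edges

theorem gauge_sChain (z : Circle) (w : V) (l : List Ed) :
    gauge E z (sChain E w l) = ((z ^ l.length : Circle) : ℂ) • sChain E w l := by
  induction l generalizing w with
  | nil => simp [sChain, gauge]
  | cons e l ih =>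
    rw [sChain, map_mul, ih, gauge, act_s, smul_mul_smul_comm, List.length_cons, pow_succ',
      Circle.coe_mul]

theorem gauge_sPath_mul_star (z : Circle) (μ ν : E.Path) :
    gauge E z (sPath μ * star (sPath ν)) =
      ((z ^ ((μ.length : ℤ) - ν.length) : Circle) : ℂ) • (sPath μ * star (sPath ν)) := by
  rw [map_mul, map_star, sPath, sPath, gauge_sChain, gauge_sChain, star_smul, smul_mul_smul_comm,
    zpow_sub, zpow_natCast, zpow_natCast, Circle.coe_mul, Circle.coe_inv_eq_conj]
  rfl

/-- `s_μ s_ν^*`, for `|μ| = |ν|`, as an element of the core. -/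
noncomputable def coreElem (μ ν : E.Path) (h : μ.length = ν.length) : core E :=
  ⟨sPath μ * star (sPath ν), fun z => by rw [gauge_sPath_mul_star]; simp [h]⟩

/-- `p_v` as an element of the core. -/
noncomputable def coreProj (v : V) : core E := ⟨p E v, fun _ => act_p E _ v⟩

/-! ### The conditional expectation onto the core -/

theorem continuous_gauge_apply (a : GraphCStar E) : Continuous fun z => gauge E z a := by
  let T : NonUnitalStarSubalgebra ℂ (GraphCStar E) :=
    { carrier := {a | Continuous fun z => gauge E z a}
      add_mem' := fun {a b} ha hb => by
        simp only [Set.mem_ofPred_eq, map_add] at *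
        exact ha.add hb
      zero_mem' := by simp only [Set.mem_ofPred_eq, map_zero]; exact continuous_const
      mul_mem' := fun {a b} ha hb => by
        simp only [Set.mem_ofPred_eq, map_mul] at *
        exact ha.mul hb
      smul_mem' := fun k a ha => by
        simp only [Set.mem_ofPred_eq, map_smul] at *
        exact ha.const_smul k
      star_mem' := fun {a} ha => by
        simp only [Set.mem_ofPred_eq, map_star] at *
        exact ha.star }
  refine mem_of_closed E T ?_ (fun v => ?_) (fun e => ?_) a
  · refine isClosed_of_closure_subset fun a ha => ?_
    obtain ⟨x, hx, hxa⟩ := mem_closure_iff_seq_limit.1 ha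
    have hu : TendstoUniformly (fun n z => gauge E z (x n)) (fun z => gauge E z a)
        Filter.atTop := by
      rw [Metric.tendstoUniformly_iff]
      intro ε hε
      filter_upwards [Metric.tendsto_nhds.1 hxa ε hε] with n hn z
      rw [dist_comm, dist_eq_norm, ← map_sub]
      exact (norm_act_le E _ _).trans_lt (by rwa [dist_eq_norm] at hn)
    exact hu.continuous (Filter.Frequently.of_forall hx)
  · exact (continuous_const : Continuous fun _ : Circle => p E v)
  · exact (continuous_subtype_val.smul continuous_const :
      Continuous fun z : Circle => (z : ℂ) • s E e)

/-- The average `∫_𝕋 γ_z(a) dz` with respect to normalized Haar measure. -/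
noncomputable def average (a : GraphCStar E) : GraphCStar E :=
  ∫ t : UnitAddCircle, gauge E (AddCircle.toCircle t) a ∂AddCircle.haarAddCircle

theorem integrable_gauge (a : GraphCStar E) :
    MeasureTheory.Integrable (fun t : UnitAddCircle => gauge E (AddCircle.toCircle t) a)
      AddCircle.haarAddCircle :=
  ((continuous_gauge_apply a).comp
    AddCircle.continuous_toCircle).integrable_of_hasCompactSupport
      (HasCompactSupport.of_compactSpace _)

theorem gauge_mul (z w : Circle) (a : GraphCStar E) :
    gauge E (z * w) a = gauge E z (gauge E w a) := act_mul E (fun _ => z) (fun _ => w) a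

theorem average_gauge (w : Circle) (a : GraphCStar E) : average (gauge E w a) = average a := by
  obtain ⟨r, rfl⟩ : ∃ r : UnitAddCircle, AddCircle.toCircle r = w := by
    obtain ⟨r, hr⟩ := (AddCircle.homeomorphCircle (T := (1 : ℝ)) one_ne_zero).surjective w
    exact ⟨r, by rw [← hr, AddCircle.homeomorphCircle_apply]⟩
  unfold average
  simp only [← gauge_mul, ← AddCircle.toCircle_add]
  exact MeasureTheory.integral_add_right_eq_self
    (fun t : UnitAddCircle => gauge E (AddCircle.toCircle t) a) r

theorem gauge_average (w : Circle) (a : GraphCStar E) : gauge E w (average a) = average a := by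
  let L : GraphCStar E →L[ℂ] GraphCStar E :=
    ⟨(gauge E w : GraphCStar E →ₗ[ℂ] GraphCStar E), map_continuous (gauge E w)⟩
  have h : gauge E w (average a) = average (gauge E w a) := by
    have := L.integral_comp_comm (integrable_gauge a)
    refine this.symm.trans ?_
    unfold average
    refine MeasureTheory.integral_congr_ae (Filter.Eventually.of_forall fun t => ?_)
    show gauge E w (gauge E _ a) = gauge E _ (gauge E w a)
    rw [← gauge_mul, mul_comm, gauge_mul]
  rw [h, average_gauge]

theorem norm_average_le (a : GraphCStar E) : ‖average a‖ ≤ 1 * ‖a‖ := by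
  refine (MeasureTheory.norm_integral_le_of_norm_le_const
    (Filter.Eventually.of_forall fun t => norm_act_le E _ a)).trans ?_
  simp

variable (E)

/-- The conditional expectation `Φ : C*(E) → C*(E)^γ`, `Φ(a) = ∫_𝕋 γ_z(a) dz`. -/
noncomputable def coreExp : GraphCStar E →L[ℂ] core E :=
  LinearMap.mkContinuous
    { toFun := fun a => ⟨average a, fun w => gauge_average w a⟩
      map_add' := fun a b => Subtype.ext <| by
        show average (a + b) = average a + average b
        unfold average
        simp only [map_add]
        exact MeasureTheory.integral_add (integrable_gauge a) (integrable_gauge b)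
      map_smul' := fun k a => Subtype.ext <| by
        show average (k • a) = k • average a
        unfold average
        simp only [map_smul]
        exact MeasureTheory.integral_smul k _ } 1 norm_average_le

variable {E}

theorem coreExp_coe (a : core E) : coreExp E (a : GraphCStar E) = a := by
  apply Subtype.ext
  show average (a : GraphCStar E) = a
  unfold average
  simp only [a.2 _]
  simp

/-- `Φ(s_μ s_ν^*) = [|μ| = |ν|] s_μ s_ν^*`. -/
theorem coreExp_sPath (μ ν : E.Path) :
    ((coreExp E (sPath μ * star (sPath ν)) : core E) : GraphCStar E) =
      if μ.length = ν.length then sPath μ * star (sPath ν) else 0 := by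
  split_ifs with h
  · exact congrArg Subtype.val (coreExp_coe (coreElem μ ν h))
  · show average (sPath μ * star (sPath ν)) = 0
    set a := sPath μ * star (sPath ν) with ha
    set k : ℤ := (μ.length : ℤ) - ν.length with hk
    have hk0 : k ≠ 0 := by omega
    set w : Circle := Circle.exp (Real.pi / k) with hw
    have hwk : w ^ k = Circle.exp Real.pi := by
      rw [hw, ← Circle.exp_zsmul, zsmul_eq_mul]
      congr 1
      field_simp
    have h1 : average a = ((w ^ k : Circle) : ℂ) • average a := by
      conv_lhs => rw [← average_gauge w a, ha, gauge_sPath_mul_star]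
      rw [← ha, ← hk]
      unfold average
      simp only [map_smul]
      exact MeasureTheory.integral_smul _ _
    rw [hwk, Circle.coe_exp, Complex.exp_pi_mul_I, neg_one_smul] at h1
    have h2 : (2 : ℂ) • average a = 0 := by
      rw [two_smul]
      exact eq_neg_iff_add_eq_zero.1 h1
    exact (smul_eq_zero.1 h2).resolve_left two_ne_zero

/-! ### States, KMS states -/

/-- A state of a C*-algebra: a positive linear functional of norm one. -/
def IsState {A : Type*} [NonUnitalCStarAlgebra A] (φ : A →L[ℂ] ℂ) : Prop :=
  (∀ a, 0 ≤ φ (star a * a)) ∧ ‖φ‖ = 1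

/-- `f` is an entire function that extends `t ↦ σ_t(x)`; so `x` is an analytic element for `σ`
and `f ζ = σ_ζ(x)`. -/
def IsAnalyticExtension {A : Type*} [NonUnitalCStarAlgebra A] (σ : ℝ → A →⋆ₙₐ[ℂ] A) (x : A)
    (f : ℂ → A) : Prop :=
  Differentiable ℂ f ∧ ∀ t : ℝ, f t = σ t x

/-- `φ` is a `(σ, β)`-KMS state: `φ(xy) = φ(y σ_{iβ}(x))` for all analytic elements `x, y`. -/
def IsKMSState {A : Type*} [NonUnitalCStarAlgebra A] (σ : ℝ → A →⋆ₙₐ[ℂ] A) (β : ℝ)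
    (φ : A →L[ℂ] ℂ) : Prop :=
  IsState φ ∧ ∀ (x y : A) (f g : ℂ → A), IsAnalyticExtension σ x f → IsAnalyticExtension σ y g →
    φ (x * y) = φ (y * f (Complex.I * β))

variable (E)

/-- The inclusion of the core into `C*(E)`. -/
noncomputable def coreIncl : core E →L[ℂ] GraphCStar E :=
  ⟨(NonUnitalStarSubalgebraClass.subtype (core E) : core E →ₗ[ℂ] GraphCStar E),
    continuous_subtype_val⟩

/-- The `(σ^c, β)`-KMS states on `C*(E)`. -/
def KMSStates (c : Ed → ℝ) (β : ℝ) : Set (GraphCStar E →L[ℂ] ℂ) :=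
  {φ | IsKMSState (dynamics E c) β φ}

open Classical in
/-- The states `ω` on the core with `ω(s_μ s_ν^*) = [μ = ν] c(μ)^{-β} ω(p_{s(μ)})` for all paths
`μ, ν` with `|μ| = |ν|` and `s(μ) = s(ν)`. -/
def CoreStates (c : Ed → ℝ) (β : ℝ) : Set (core E →L[ℂ] ℂ) :=
  {ω | IsState ω ∧ ∀ (μ ν : E.Path) (h : μ.length = ν.length), μ.src = ν.src →
    ω (coreElem μ ν h) =
      if μ = ν then ((μ.weight c ^ (-β) : ℝ) : ℂ) * ω (coreProj μ.src) else 0}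

end GraphAlg

/-! The bridge between KMS states and core states is a pair of algebraic conditions on a functional.
`IsTwistedTrace` says that generators move cyclically inside φ, with φ(s_e y) = c(e)^{-β} φ(y s_e).
`IsDiagonal` is the formula (*) for all pairs of paths, with no restriction on lengths or sources. A
KMS state is a twisted trace: generators and the elements s_μ s_ν^* are eigenvectors of the
dynamics, hence analytic, and the s_μ s_ν^* span a dense subspace (`mem_pathSpan`). A positive
twisted trace is diagonal: rotating the first edge of μ to the right cancels it against the first
edge of ν or gives zero. What remains is φ(s_μ) with |μ| > 0, and φ(s_μ) = c(μ)^{-β} φ(s_μ) forces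
it to vanish because c(μ) ≠ 1. In particular φ kills s_μ s_ν^* for |μ| ≠ |ν|, so φ factors through
Φ. Conversely, if ω satisfies (*), then ω ∘ Φ is diagonal, hence a twisted trace and invariant under
the dynamics. The KMS identity for an analytic x and y = s_μ s_ν^* follows by continuing an identity
of entire functions from the real line to iβ; density gives all y. Since C*(E) may lack a unit,
norms of states are computed along the finite sums of vertex projections. These form an approximate
unit lying in the core, so restriction, composition with Φ and convex combinations all preserve norm
one. -/

namespace GraphAlg

open Filter Topology

/-! ### Positive functionals -/

section Positive

variable {A : Type*} [NonUnitalCStarAlgebra A] {φ : A →L[ℂ] ℂ}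

/-- A functional that is nonnegative on all `a^* a` commutes with the involution. -/
theorem map_star_of_positive (hφ : ∀ a, 0 ≤ φ (star a * a)) (a : A) :
    φ (star a) = star (φ a) := by
  -- In the spectral order the nonnegative elements are exactly the b^* b, so φ becomes a positive
  -- linear map, and such maps preserve the involution.
  let _ := CStarAlgebra.spectralOrder A
  have _ := CStarAlgebra.spectralOrderedRing A
  let f : A →ₚ[ℂ] ℂ := PositiveLinearMap.mk₀ φ.toLinearMap fun a ha => by
    obtain ⟨b, rfl⟩ := CStarAlgebra.nonneg_iff_eq_star_mul_self.1 ha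
    exact hφ b
  exact map_star f a

/-- The Cauchy-Schwarz inequality for positive functionals. -/
theorem norm_sq_le_of_positive (hφ : ∀ a, 0 ≤ φ (star a * a)) (a b : A) :
    ‖φ (star a * b)‖ ^ 2 ≤ (φ (star a * a)).re * (φ (star b * b)).re := by
  let c : PreInnerProductSpace.Core ℂ A :=
    { inner := fun a b => φ (star a * b)
      conj_inner_symm := fun a b => by
        rw [← Complex.star_def, ← map_star_of_positive hφ, star_mul, star_star]
      re_inner_nonneg := fun a => (Complex.nonneg_iff.1 (hφ a)).1
      add_left := fun a b d => by rw [star_add, add_mul, map_add]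
      smul_left := fun a b r => by
        rw [star_smul, smul_mul_assoc, map_smul, smul_eq_mul]; rfl }
  have h := InnerProductSpace.Core.inner_mul_inner_self_le (c := c) a b
  have hs : ‖φ (star b * a)‖ = ‖φ (star a * b)‖ := by
    rw [← norm_star, ← map_star_of_positive hφ, star_mul, star_star]
  rw [sq]
  nth_rewrite 2 [← hs]
  exact h

/-- Along an approximate unit of projections a positive functional converges to its norm. -/
theorem tendsto_norm_of_positive (hφ : ∀ a, 0 ≤ φ (star a * a)) {ι : Type*} {l : Filter ι}
    {q : ι → A} (hq : ∀ i, IsStarProjection (q i)) (hl : ∀ a, Tendsto (fun i => q i * a) l (𝓝 a)) :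
    Tendsto (fun i => φ (q i)) l (𝓝 (‖φ‖ : ℂ)) := by
  have hstar : ∀ i, star (q i) * q i = q i := fun i => by
    rw [(hq i).isSelfAdjoint.star_eq, (hq i).isIdempotentElem.eq]
  have hpos : ∀ i, 0 ≤ φ (q i) := fun i => by
    have := hφ (q i)
    rwa [hstar] at this
  have hcoe : ∀ i, φ (q i) = ((φ (q i)).re : ℂ) := fun i =>
    Complex.eq_re_of_ofReal_le (r := 0) (by simpa using hpos i)
  have hre : ∀ i, (φ (q i)).re = ‖φ (q i)‖ := fun i => by
    rw [hcoe i, Complex.norm_real, Complex.ofReal_re, Real.norm_of_nonneg]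
    exact (Complex.nonneg_iff.1 (hpos i)).1
  have hqn : ∀ i, ‖q i‖ ≤ 1 := fun i => by
    have h1 : ‖q i‖ * ‖q i‖ = ‖q i‖ := by rw [← CStarRing.norm_star_mul_self, hstar]
    nlinarith [norm_nonneg (q i)]
  have hle : ∀ i, (φ (q i)).re ≤ ‖φ‖ := fun i => by
    rw [hre]
    exact (φ.le_opNorm _).trans (mul_le_of_le_one_right (norm_nonneg _) (hqn i))
  suffices h : Tendsto (fun i => (φ (q i)).re) l (𝓝 ‖φ‖) by
    have h2 := (Complex.continuous_ofReal.tendsto _).comp h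
    exact h2.congr fun i => (hcoe i).symm
  rcases (norm_nonneg φ).eq_or_lt with h0 | h0
  · refine tendsto_const_nhds.congr fun i => ?_
    rw [← h0]
    exact le_antisymm (Complex.nonneg_iff.1 (hpos i)).1 (h0 ▸ hle i)
  rw [tendsto_order]
  refine ⟨fun r hr => ?_, fun r hr => Eventually.of_forall fun i => (hle i).trans_lt hr⟩
  rcases lt_or_ge r 0 with hr0 | hr0
  · exact Eventually.of_forall fun i => hr0.trans_le (Complex.nonneg_iff.1 (hpos i)).1
  -- Choose a in the unit ball with |φ(a)|² > r‖φ‖. Eventually |φ(q a)|² > r‖φ‖ too, while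
  -- Cauchy-Schwarz gives |φ(q a)|² ≤ φ(q) φ(a^* a) ≤ φ(q)‖φ‖; dividing by ‖φ‖ yields φ(q) > r.
  have hsq : Real.sqrt (r * ‖φ‖) < ‖φ‖ := by
    rw [Real.sqrt_lt' h0]
    nlinarith
  obtain ⟨a, ha, hra⟩ := φ.exists_lt_apply_of_lt_opNorm hsq
  have hlim : Tendsto (fun i => ‖φ (q i * a)‖) l (𝓝 ‖φ a‖) :=
    ((φ.continuous.tendsto _).comp (hl a)).norm
  filter_upwards [hlim.eventually (lt_mem_nhds hra)] with i hi
  have h1 := norm_sq_le_of_positive hφ (q i) a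
  rw [hstar, (hq i).isSelfAdjoint.star_eq] at h1
  have h2 : (φ (star a * a)).re ≤ ‖φ‖ := by
    refine (Complex.re_le_norm _).trans ((φ.le_opNorm _).trans ?_)
    refine mul_le_of_le_one_right (norm_nonneg _) ?_
    rw [CStarRing.norm_star_mul_self]
    nlinarith [norm_nonneg a]
  have h3 : r * ‖φ‖ < ‖φ (q i * a)‖ ^ 2 := by
    have := Real.lt_sq_of_sqrt_lt hi
    exact this
  have h4 : (φ (q i)).re * (φ (star a * a)).re ≤ (φ (q i)).re * ‖φ‖ :=
    mul_le_mul_of_nonneg_left h2 (Complex.nonneg_iff.1 (hpos i)).1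
  exact lt_of_mul_lt_mul_right (h3.trans_le (h1.trans h4)) h0.le

/-- A convex combination of states is a state, given an approximate unit of projections. -/
theorem IsState.convex {ψ : A →L[ℂ] ℂ} (hφ : IsState φ) (hψ : IsState ψ) {ι : Type*}
    {l : Filter ι} [l.NeBot] {q : ι → A} (hq : ∀ i, IsStarProjection (q i))
    (hl : ∀ a, Tendsto (fun i => q i * a) l (𝓝 a)) {a b : ℝ} (ha : 0 ≤ a) (hb : 0 ≤ b)
    (hab : a + b = 1) : IsState ((a : ℂ) • φ + (b : ℂ) • ψ) := by
  have hpos : ∀ x, 0 ≤ ((a : ℂ) • φ + (b : ℂ) • ψ) (star x * x) := fun x =>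
    add_nonneg (mul_nonneg (by exact_mod_cast ha) (hφ.1 x))
      (mul_nonneg (by exact_mod_cast hb) (hψ.1 x))
  refine ⟨hpos, ?_⟩
  -- On positive functionals the norm is a limit of values, hence additive; the triangle inequality
  -- alone would give only ≤ 1.
  have h1 := tendsto_norm_of_positive hpos hq hl
  have h2 := ((tendsto_norm_of_positive hφ.1 hq hl).const_mul (a : ℂ)).add
    ((tendsto_norm_of_positive hψ.1 hq hl).const_mul (b : ℂ))
  have h3 := tendsto_nhds_unique h1 h2
  rw [hφ.2, hψ.2] at h3
  have h4 : ‖(a : ℂ) • φ + (b : ℂ) • ψ‖ = a * 1 + b * 1 := by exact_mod_cast h3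
  rw [h4, mul_one, mul_one, hab]

end Positive

/-! ### The approximate unit of finite sums of vertex projections -/

section Generators

variable {V : Type u} {Ed : Type v} (E : DirGraph V Ed)

theorem p_mul_p_self (v : V) : p E v * p E v = p E v :=
  ((isCKFamily E).proj v).isIdempotentElem.eq

theorem star_p (v : V) : star (p E v) = p E v := ((isCKFamily E).proj v).isSelfAdjoint.star_eq

theorem p_mul_s (e : Ed) : p E (E.rng e) * s E e = s E e := by
  rw [← (isCKFamily E).partial_isometry, ← mul_assoc, (isCKFamily E).range_le]

theorem p_mul_s_of_ne {w : V} {e : Ed} (h : E.rng e ≠ w) : p E w * s E e = 0 := by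
  rw [← p_mul_s, ← mul_assoc, (isCKFamily E).proj_orthogonal _ _ h.symm, zero_mul]

theorem star_s_mul_s_of_ne {e f : Ed} (h : e ≠ f) : star (s E e) * s E f = 0 := by
  have h1 : star (s E e) = star (s E e) * (s E e * star (s E e)) := by
    conv_lhs => rw [← (isCKFamily E).partial_isometry e]
    simp [mul_assoc]
  have h2 : s E f = s E f * star (s E f) * s E f := ((isCKFamily E).partial_isometry f).symm
  rw [h1, h2, mul_assoc, ← mul_assoc _ _ (s E f), (isCKFamily E).range_orthogonal e f h, zero_mul,
    mul_zero]

/-- The projection `∑_{v ∈ F} p_v`. -/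
noncomputable def vertexSum (F : Finset V) : GraphCStar E := ∑ v ∈ F, p E v

theorem vertexSum_mul {F : Finset V} {w : V} (hw : w ∈ F) {a : GraphCStar E}
    (h : p E w * a = a) : vertexSum E F * a = a := by
  rw [vertexSum, Finset.sum_mul, Finset.sum_eq_single_of_mem w hw, h]
  intro v _ hv
  rw [← h, ← mul_assoc, (isCKFamily E).proj_orthogonal _ _ hv, zero_mul]

theorem star_vertexSum (F : Finset V) : star (vertexSum E F) = vertexSum E F := by
  simp [vertexSum, star_sum, star_p]

theorem isStarProjection_vertexSum (F : Finset V) : IsStarProjection (vertexSum E F) := by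
  refine ⟨?_, star_vertexSum E F⟩
  show vertexSum E F * vertexSum E F = vertexSum E F
  conv_lhs => enter [2]; rw [vertexSum]
  rw [Finset.mul_sum]
  exact Finset.sum_congr rfl fun v hv => vertexSum_mul E hv (p_mul_p_self E v)

theorem norm_vertexSum_le (F : Finset V) : ‖vertexSum E F‖ ≤ 1 := by
  have h := isStarProjection_vertexSum E F
  have h1 : ‖vertexSum E F‖ * ‖vertexSum E F‖ = ‖vertexSum E F‖ := by
    rw [← CStarRing.norm_star_mul_self, h.isSelfAdjoint.star_eq, h.isIdempotentElem.eq]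
  nlinarith [norm_nonneg (vertexSum E F)]

theorem mul_vertexSum {F : Finset V} {w : V} (hw : w ∈ F) {a : GraphCStar E}
    (h : a * p E w = a) : a * vertexSum E F = a := by
  have := vertexSum_mul E hw (a := star a) (by rw [← star_p, ← star_mul, h])
  rw [← star_vertexSum, ← star_mul] at this
  exact star_injective this

/-- The elements on which the finite sums of vertex projections act as a two-sided approximate
unit. -/
noncomputable def approxUnitSubalgebra : NonUnitalStarSubalgebra ℂ (GraphCStar E) where
  carrier := {a | Tendsto (fun F => vertexSum E F * a) atTop (𝓝 a) ∧
    Tendsto (fun F => a * vertexSum E F) atTop (𝓝 a)}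
  add_mem' ha hb := ⟨by simpa [mul_add] using ha.1.add hb.1, by simpa [add_mul] using ha.2.add hb.2⟩
  zero_mem' := by simp
  mul_mem' {a b} ha hb := ⟨by simpa [mul_assoc] using ha.1.mul_const b,
    by simpa [mul_assoc] using hb.2.const_mul a⟩
  smul_mem' k a ha := ⟨by simpa only [mul_smul_comm] using ha.1.const_smul k,
    by simpa only [smul_mul_assoc] using ha.2.const_smul k⟩
  star_mem' {a} ha := ⟨by simpa [star_vertexSum] using ha.2.star,
    by simpa [star_vertexSum] using ha.1.star⟩

theorem isClosed_approxUnitSubalgebra :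
    IsClosed (approxUnitSubalgebra E : Set (GraphCStar E)) := by
  -- For maps that are 1-Lipschitz uniformly in F, the set of points where they converge to the
  -- identity is closed.
  have key : ∀ L : Finset V → GraphCStar E → GraphCStar E,
      (∀ F a b, dist (L F a) (L F b) ≤ dist a b) →
      IsClosed {a | Tendsto (fun F => L F a) atTop (𝓝 a)} := by
    intro L hL
    refine isClosed_of_closure_subset fun a ha => ?_
    rw [Set.mem_ofPred_eq, Metric.tendsto_nhds]
    intro ε hε
    obtain ⟨b, hb, hab⟩ := Metric.mem_closure_iff.1 ha (ε / 3) (by positivity)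
    filter_upwards [Metric.tendsto_nhds.1 hb (ε / 3) (by positivity)] with F hF
    have h1 := hL F a b
    have h2 := dist_triangle4 (L F a) (L F b) b a
    rw [dist_comm b a] at h2
    linarith
  have := norm_vertexSum_le E
  refine (key (fun F a => vertexSum E F * a) fun F a b => ?_).inter
    (key (fun F a => a * vertexSum E F) fun F a b => ?_)
  · rw [dist_eq_norm, dist_eq_norm, ← mul_sub]
    exact (norm_mul_le _ _).trans (mul_le_of_le_one_left (norm_nonneg _) (this F))
  · rw [dist_eq_norm, dist_eq_norm, ← sub_mul]
    exact (norm_mul_le _ _).trans (mul_le_of_le_one_right (norm_nonneg _) (this F))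

/-- A generator is fixed on the left once F contains its range and on the right once F contains its
source, so both nets are eventually constant. -/
theorem mem_approxUnitSubalgebra (a : GraphCStar E) : a ∈ approxUnitSubalgebra E := by
  have ev : ∀ w : V, ∀ᶠ F : Finset V in atTop, w ∈ F := fun w =>
    (eventually_ge_atTop {w}).mono fun F hF => hF (Finset.mem_singleton_self w)
  refine mem_of_closed E _ (isClosed_approxUnitSubalgebra E) (fun v => ⟨?_, ?_⟩)
    (fun e => ⟨?_, ?_⟩) a
  · exact tendsto_const_nhds.congr' ((ev v).mono fun F h =>
      (vertexSum_mul E h (p_mul_p_self E v)).symm)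
  · exact tendsto_const_nhds.congr' ((ev v).mono fun F h =>
      (mul_vertexSum E h (p_mul_p_self E v)).symm)
  · exact tendsto_const_nhds.congr' ((ev _).mono fun F h => (vertexSum_mul E h (p_mul_s E e)).symm)
  · exact tendsto_const_nhds.congr' ((ev _).mono fun F h => (mul_vertexSum E h (s_mul_p E e)).symm)

theorem tendsto_vertexSum_mul (a : GraphCStar E) :
    Tendsto (fun F => vertexSum E F * a) atTop (𝓝 a) := (mem_approxUnitSubalgebra E a).1

theorem tendsto_mul_vertexSum (a : GraphCStar E) :
    Tendsto (fun F => a * vertexSum E F) atTop (𝓝 a) := (mem_approxUnitSubalgebra E a).2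

/-- The projection `∑_{v ∈ F} p_v` as an element of the core. -/
noncomputable def coreVertexSum (F : Finset V) : core E :=
  ⟨vertexSum E F, fun z => by rw [vertexSum, map_sum]; rfl⟩

theorem isStarProjection_coreVertexSum (F : Finset V) : IsStarProjection (coreVertexSum E F) :=
  ⟨Subtype.ext (isStarProjection_vertexSum E F).isIdempotentElem,
    Subtype.ext (star_vertexSum E F)⟩

theorem tendsto_coreVertexSum_mul (a : core E) :
    Tendsto (fun F => coreVertexSum E F * a) atTop (𝓝 a) :=
  tendsto_subtype_rng.2 (tendsto_vertexSum_mul E a)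

/-! ### Restricting states to the core and extending them from it -/

variable {E}

/-- The approximate unit lies in the core, so the norms of φ and of its restriction are the same
limit. -/
theorem IsState.comp_coreIncl {φ : GraphCStar E →L[ℂ] ℂ} (hφ : IsState φ) :
    IsState (φ ∘L coreIncl E) := by
  have hpos : ∀ a, 0 ≤ (φ ∘L coreIncl E) (star a * a) := fun a => hφ.1 (a : GraphCStar E)
  refine ⟨hpos, ?_⟩
  have h1 := tendsto_norm_of_positive hpos (isStarProjection_coreVertexSum E)
    (tendsto_coreVertexSum_mul E)
  have h2 := tendsto_norm_of_positive hφ.1 (isStarProjection_vertexSum E)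
    (tendsto_vertexSum_mul E)
  have h3 := tendsto_nhds_unique h1 h2
  rw [hφ.2] at h3
  exact_mod_cast h3

/-- `Φ(a^* a)` is of the form `b^* b` with `b` in the core. -/
theorem exists_coreExp_star_mul_self (a : GraphCStar E) :
    ∃ b : core E, coreExp E (star a * a) = star b * b := by
  let _ := CStarAlgebra.spectralOrder (GraphCStar E)
  have _ := CStarAlgebra.spectralOrderedRing (GraphCStar E)
  have hpos : 0 ≤ average (star a * a) := by
    -- The average over a probability measure stays in the closed convex cone of positive elements.
    have hconv : Convex ℝ {x : GraphCStar E | 0 ≤ x} := by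
      intro x hx y hy a b ha hb _
      rw [Set.mem_ofPred_eq] at *
      exact add_nonneg (smul_nonneg ha hx) (smul_nonneg hb hy)
    refine hconv.integral_mem CStarAlgebra.isClosed_nonneg
      (Eventually.of_forall fun t => ?_) (integrable_gauge _)
    rw [Set.mem_ofPred_eq, map_mul, map_star]
    exact star_mul_self_nonneg _
  have hsa : star (CFC.sqrt (average (star a * a))) = CFC.sqrt (average (star a * a)) :=
    (IsSelfAdjoint.of_nonneg (CFC.sqrt_nonneg _)).star_eq
  refine ⟨⟨CFC.sqrt (average (star a * a)), fun z => ?_⟩, Subtype.ext ?_⟩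
  -- The root is gauge invariant: γ_z maps it to another positive square root of the same invariant
  -- element.
  · refine (CFC.sqrt_unique ?_ ?_).symm
    · rw [← map_mul, CFC.sqrt_mul_sqrt_self _ hpos, gauge_average]
    · exact map_nonneg (gauge E z) (CFC.sqrt_nonneg _)
  · show average (star a * a) = star (CFC.sqrt (average (star a * a))) * _
    rw [hsa, CFC.sqrt_mul_sqrt_self _ hpos]

theorem IsState.comp_coreExp {ω : core E →L[ℂ] ℂ} (hω : IsState ω) :
    IsState (ω ∘L coreExp E) := by
  have hpos : ∀ a, 0 ≤ (ω ∘L coreExp E) (star a * a) := fun a => by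
    obtain ⟨b, hb⟩ := exists_coreExp_star_mul_self a
    show 0 ≤ ω (coreExp E (star a * a))
    rw [hb]
    exact hω.1 b
  refine ⟨hpos, ?_⟩
  have h1 := tendsto_norm_of_positive hω.1 (isStarProjection_coreVertexSum E)
    (tendsto_coreVertexSum_mul E)
  have h2 := tendsto_norm_of_positive hpos (isStarProjection_vertexSum E)
    (tendsto_vertexSum_mul E)
  have h3 : ∀ F, (ω ∘L coreExp E) (vertexSum E F) = ω (coreVertexSum E F) := fun F =>
    congrArg ω (coreExp_coe (coreVertexSum E F))
  have h4 := tendsto_nhds_unique h2 (h1.congr fun F => (h3 F).symm)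
  rw [hω.2] at h4
  exact_mod_cast h4

end Generators

variable {V : Type u} {Ed : Type v} {E : DirGraph V Ed}

/-! ### The elements `s_μ` -/

theorem p_mul_sChain {w : V} {l : List Ed} (h : E.Chain w l) :
    p E w * sChain E w l = sChain E w l := by
  cases l with
  | nil => exact p_mul_p_self E w
  | cons e l =>
    obtain ⟨rfl, -⟩ := h
    rw [sChain, ← mul_assoc, p_mul_s]

theorem p_mul_sChain_of_ne {v w : V} {l : List Ed} (h : E.Chain w l) (hv : v ≠ w) :
    p E v * sChain E w l = 0 := by
  rw [← p_mul_sChain h, ← mul_assoc, (isCKFamily E).proj_orthogonal _ _ hv, zero_mul]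

theorem sChain_mul_p (w : V) (l : List Ed) :
    sChain E w l * p E (E.chainSrc w l) = sChain E w l := by
  induction l generalizing w with
  | nil => exact p_mul_p_self E w
  | cons e l ih => rw [sChain, mul_assoc, DirGraph.chainSrc, ih]

theorem sChain_mul_p_of_ne {v w : V} {l : List Ed} (hv : E.chainSrc w l ≠ v) :
    sChain E w l * p E v = 0 := by
  rw [← sChain_mul_p, mul_assoc, (isCKFamily E).proj_orthogonal _ _ hv, mul_zero]

theorem p_mul_star_sChain (w : V) (l : List Ed) :
    p E (E.chainSrc w l) * star (sChain E w l) = star (sChain E w l) := by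
  rw [← star_p, ← star_mul, sChain_mul_p]

theorem s_mul_sChain_of_ne {e : Ed} {w : V} {l : List Ed} (h : E.Chain w l) (he : E.src e ≠ w) :
    s E e * sChain E w l = 0 := by
  rw [← s_mul_p, mul_assoc, p_mul_sChain_of_ne h he, mul_zero]

theorem star_s_mul_sChain_cons {e : Ed} {w : V} {l : List Ed} (h : E.Chain w (e :: l)) :
    star (s E e) * sChain E w (e :: l) = sChain E (E.src e) l := by
  rw [sChain, ← mul_assoc, (isCKFamily E).star_mul_self, p_mul_sChain h.2]

theorem star_s_mul_sChain_cons_of_ne {e f : Ed} {w : V} {l : List Ed} (h : e ≠ f) :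
    star (s E e) * sChain E w (f :: l) = 0 := by
  rw [sChain, ← mul_assoc, star_s_mul_s_of_ne E h, zero_mul]

/-- Paths are built from the range end, so extending one at its source needs an induction. -/
theorem sChain_mul_s {w : V} {l : List Ed} {e : Ed} (h : E.Chain w l)
    (he : E.chainSrc w l = E.rng e) :
    E.Chain w (l ++ [e]) ∧ sChain E w (l ++ [e]) = sChain E w l * s E e := by
  induction l generalizing w with
  | nil =>
    obtain rfl : w = E.rng e := he
    exact ⟨⟨rfl, trivial⟩, by rw [List.nil_append, sChain, sChain, sChain, s_mul_p, p_mul_s]⟩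
  | cons f l ih =>
    obtain ⟨h1, h2⟩ := ih h.2 he
    exact ⟨⟨h.1, h1⟩, by rw [List.cons_append, sChain, sChain, h2, mul_assoc]⟩

theorem sChain_mul_s_of_ne {w : V} {l : List Ed} {e : Ed} (he : E.chainSrc w l ≠ E.rng e) :
    sChain E w l * s E e = 0 := by
  rw [← p_mul_s, ← mul_assoc, sChain_mul_p_of_ne he, zero_mul]

/-! ### The elements `s_μ s_ν^*` span a dense subspace -/

variable (E) in
/-- The closed linear span of the elements `s_μ s_ν^*`. -/
noncomputable def pathSpan : Submodule ℂ (GraphCStar E) :=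
  (Submodule.span ℂ
    (Set.range fun x : E.Path × E.Path => sPath x.1 * star (sPath x.2))).topologicalClosure

theorem isClosed_pathSpan : IsClosed (pathSpan E : Set (GraphCStar E)) :=
  Submodule.isClosed_topologicalClosure _

theorem sChain_mem_pathSpan {w w' : V} {l l' : List Ed} (h : E.Chain w l) (h' : E.Chain w' l') :
    sChain E w l * star (sChain E w' l') ∈ pathSpan E :=
  Submodule.le_topologicalClosure _ (Submodule.subset_span ⟨(⟨w, l, h⟩, ⟨w', l', h'⟩), rfl⟩)

theorem star_sChain_mem_pathSpan {w : V} {l : List Ed} (h : E.Chain w l) :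
    star (sChain E w l) ∈ pathSpan E := by
  rw [← p_mul_star_sChain]
  exact sChain_mem_pathSpan (l := []) trivial h

theorem pathSpan_le {T : Submodule ℂ (GraphCStar E)} (hT : IsClosed (T : Set (GraphCStar E)))
    (h : ∀ w l w' l', E.Chain w l → E.Chain w' l' →
      sChain E w l * star (sChain E w' l') ∈ T) : pathSpan E ≤ T := by
  refine Submodule.topologicalClosure_minimal _ (Submodule.span_le.2 ?_) hT
  rintro _ ⟨⟨μ, ν⟩, rfl⟩
  exact h _ _ _ _ μ.chain ν.chain

variable (E) in
/-- The elements `a` such that left multiplication by `a` and `a^*` preserves `pathSpan`. -/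
noncomputable def pathSpanMultiplier : NonUnitalStarSubalgebra ℂ (GraphCStar E) where
  carrier := {a | ∀ x ∈ pathSpan E, a * x ∈ pathSpan E ∧ star a * x ∈ pathSpan E}
  add_mem' {a b} ha hb x hx := by
    rw [star_add, add_mul, add_mul]
    exact ⟨add_mem (ha x hx).1 (hb x hx).1, add_mem (ha x hx).2 (hb x hx).2⟩
  zero_mem' x _ := by simp
  mul_mem' {a b} ha hb x hx := by
    rw [star_mul, mul_assoc, mul_assoc]
    exact ⟨(ha _ (hb x hx).1).1, (hb _ (ha x hx).2).2⟩
  smul_mem' k a ha x hx := by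
    rw [star_smul, smul_mul_assoc, smul_mul_assoc]
    exact ⟨Submodule.smul_mem _ _ (ha x hx).1, Submodule.smul_mem _ _ (ha x hx).2⟩
  star_mem' {a} ha x hx := by
    rw [star_star]
    exact ⟨(ha x hx).2, (ha x hx).1⟩

theorem isClosed_pathSpanMultiplier :
    IsClosed (pathSpanMultiplier E : Set (GraphCStar E)) := by
  have : (pathSpanMultiplier E : Set (GraphCStar E)) = ⋂ x ∈ pathSpan E,
      {a | a * x ∈ pathSpan E} ∩ {a | star a * x ∈ pathSpan E} := by
    ext a
    simp only [Set.mem_iInter]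
    exact Iff.rfl
  rw [this]
  refine isClosed_biInter fun x _ => IsClosed.inter ?_ ?_
  · exact isClosed_pathSpan.preimage (continuous_id.mul continuous_const)
  · exact isClosed_pathSpan.preimage (continuous_star.mul continuous_const)

theorem mul_mem_pathSpan_of_sChain {a : GraphCStar E} (h : ∀ w l w' l', E.Chain w l →
    E.Chain w' l' → a * (sChain E w l * star (sChain E w' l')) ∈ pathSpan E) :
    ∀ x ∈ pathSpan E, a * x ∈ pathSpan E :=
  pathSpan_le (T := (pathSpan E).comap (LinearMap.mulLeft ℂ a))
    (isClosed_pathSpan.preimage (continuous_const.mul continuous_id)) h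

/-- The multipliers form a closed *-subalgebra, so generators suffice: s_e prepends an edge to μ,
s_e^* removes the first one, and mismatches give zero. -/
theorem mem_pathSpanMultiplier (a : GraphCStar E) : a ∈ pathSpanMultiplier E := by
  classical
  refine mem_of_closed E _ isClosed_pathSpanMultiplier (fun v => ?_) (fun e => ?_) a
  · have : ∀ x ∈ pathSpan E, p E v * x ∈ pathSpan E := by
      refine mul_mem_pathSpan_of_sChain fun w l w' l' h h' => ?_
      rw [← mul_assoc]
      by_cases hv : v = w
      · rw [hv, p_mul_sChain h]
        exact sChain_mem_pathSpan h h'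
      · rw [p_mul_sChain_of_ne h hv, zero_mul]
        exact zero_mem _
    exact fun x hx => ⟨this x hx, by rw [star_p]; exact this x hx⟩
  · refine fun x hx => ⟨?_, ?_⟩
    · revert x
      refine mul_mem_pathSpan_of_sChain fun w l w' l' h h' => ?_
      rw [← mul_assoc]
      by_cases hw : E.src e = w
      · subst hw
        exact sChain_mem_pathSpan (w := E.rng e) (l := e :: l) ⟨rfl, h⟩ h'
      · rw [s_mul_sChain_of_ne h hw, zero_mul]
        exact zero_mem _
    · revert x
      refine mul_mem_pathSpan_of_sChain fun w l w' l' h h' => ?_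
      rw [← mul_assoc]
      cases l with
      | nil =>
        -- Here μ is a vertex and has no edge to cancel; instead s_e^* s_ν^* = (s_ν s_e)^* extends ν
        -- by e.
        rw [sChain, ← star_p, ← star_mul]
        by_cases hw : E.rng e = w
        · rw [← hw, p_mul_s, ← star_mul]
          by_cases he : E.chainSrc w' l' = E.rng e
          · rw [← (sChain_mul_s h' he).2]
            exact star_sChain_mem_pathSpan (sChain_mul_s h' he).1
          · rw [sChain_mul_s_of_ne he, star_zero]
            exact zero_mem _
        · rw [p_mul_s_of_ne E hw, star_zero, zero_mul]
          exact zero_mem _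
      | cons f l =>
        by_cases hf : e = f
        · subst hf
          rw [star_s_mul_sChain_cons h]
          exact sChain_mem_pathSpan h.2 h'
        · rw [star_s_mul_sChain_cons_of_ne hf, zero_mul]
          exact zero_mem _

/-- The closed span is a left ideal containing every p_v, so it contains each a ∑_{v ∈ F} p_v and
their limit a. -/
theorem mem_pathSpan (a : GraphCStar E) : a ∈ pathSpan E := by
  refine isClosed_pathSpan.mem_of_tendsto (tendsto_mul_vertexSum E a)
    (Eventually.of_forall fun F => ?_)
  refine (mem_pathSpanMultiplier a _ ?_).1
  refine Submodule.sum_mem _ fun v _ => ?_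
  rw [← star_p]
  exact star_sChain_mem_pathSpan (w := v) (l := []) trivial

/-- Continuous functionals that agree on the elements `s_μ s_ν^*` are equal. -/
theorem functional_ext {φ ψ : GraphCStar E →L[ℂ] ℂ}
    (h : ∀ w l w' l', E.Chain w l → E.Chain w' l' →
      φ (sChain E w l * star (sChain E w' l')) = ψ (sChain E w l * star (sChain E w' l'))) :
    φ = ψ := by
  ext a
  exact pathSpan_le (T := LinearMap.eqLocus φ.toLinearMap ψ.toLinearMap)
    (isClosed_eq φ.continuous ψ.continuous) h (mem_pathSpan a)

/-! ### Functionals with the KMS property on generators -/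

/-- The KMS relation between a generator of `C*(E)` and an arbitrary element. -/
structure IsTwistedTrace (c : Ed → ℝ) (β : ℝ) (φ : GraphCStar E →L[ℂ] ℂ) : Prop where
  vertex : ∀ v y, φ (p E v * y) = φ (y * p E v)
  edge : ∀ e y, φ (s E e * y) = ((c e ^ (-β) : ℝ) : ℂ) * φ (y * s E e)

open Classical in
/-- `φ(s_μ s_ν^*) = [μ = ν] c(μ)^{-β} φ(p_{s(μ)})` for all paths `μ`, `ν`. -/
def IsDiagonal (c : Ed → ℝ) (β : ℝ) (φ : GraphCStar E →L[ℂ] ℂ) : Prop :=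
  ∀ w l w' l', E.Chain w l → E.Chain w' l' →
    φ (sChain E w l * star (sChain E w' l')) =
      if w = w' ∧ l = l' then (((l.map c).prod ^ (-β) : ℝ) : ℂ) * φ (p E (E.chainSrc w l)) else 0

variable {c : Ed → ℝ} {β : ℝ} {φ : GraphCStar E →L[ℂ] ℂ}

theorem prod_map_pos (hc : ∀ e, 0 < c e) (l : List Ed) : 0 < (l.map c).prod :=
  List.prod_pos fun _ hx => by
    obtain ⟨e, -, rfl⟩ := List.mem_map.1 hx
    exact hc e

theorem prod_map_cons_rpow (hc : ∀ e, 0 < c e) (e : Ed) (l : List Ed) (r : ℝ) :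
    ((((e :: l).map c).prod ^ r : ℝ) : ℂ) = ((c e ^ r : ℝ) : ℂ) * (((l.map c).prod ^ r : ℝ) : ℂ) := by
  rw [List.map_cons, List.prod_cons, Real.mul_rpow (hc e).le (prod_map_pos hc l).le,
    Complex.ofReal_mul]

theorem IsTwistedTrace.sChain_mul (h : IsTwistedTrace c β φ) (hc : ∀ e, 0 < c e) (w : V)
    (l : List Ed) (y : GraphCStar E) :
    φ (sChain E w l * y) = (((l.map c).prod ^ (-β) : ℝ) : ℂ) * φ (y * sChain E w l) := by
  induction l generalizing w y with
  | nil => simpa [sChain] using h.vertex w y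
  | cons e l ih =>
    rw [sChain, mul_assoc, h.edge, mul_assoc, ih, prod_map_cons_rpow hc]
    simp only [mul_assoc]

/-- Moving s_μ past p_{s(μ)} and back gives φ(s_μ) = c(μ)^{-β} φ(s_μ). The factor differs from 1
because c(μ) ≠ 1 and β ≠ 0. -/
theorem IsTwistedTrace.apply_sChain_cons (h : IsTwistedTrace c β φ) (hc : ∀ e, 0 < c e)
    (hc1 : ∀ μ : E.Path, 0 < μ.length → μ.weight c ≠ 1) (hβ : 0 < β) {w : V} {e : Ed}
    {l : List Ed} (hl : E.Chain w (e :: l)) : φ (sChain E w (e :: l)) = 0 := by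
  have h1 : φ (sChain E w (e :: l)) =
      ((((e :: l).map c).prod ^ (-β) : ℝ) : ℂ) * φ (sChain E w (e :: l)) := by
    conv_lhs => rw [← sChain_mul_p, h.sChain_mul hc, h.vertex, sChain_mul_p]
  have h2 : ((e :: l).map c).prod ^ (-β) ≠ 1 := by
    rw [← Real.one_rpow (-β), Ne,
      Real.rpow_left_inj (prod_map_pos hc _).le zero_le_one (neg_ne_zero.2 hβ.ne')]
    exact hc1 ⟨w, e :: l, hl⟩ (Nat.succ_pos _)
  by_contra h0
  exact h2 (by exact_mod_cast (mul_eq_right₀ h0).1 h1.symm)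

theorem IsTwistedTrace.isDiagonal (h : IsTwistedTrace c β φ) (hφ : ∀ a, 0 ≤ φ (star a * a))
    (hc : ∀ e, 0 < c e) (hc1 : ∀ μ : E.Path, 0 < μ.length → μ.weight c ≠ 1) (hβ : 0 < β) :
    IsDiagonal c β φ := by
  classical
  have hnil : ∀ {w : V} {e : Ed} {l : List Ed} (w' : V), E.Chain w (e :: l) →
      φ (sChain E w (e :: l) * p E w') = 0 := by
    intro w e l w' hl
    by_cases hw : E.chainSrc w (e :: l) = w'
    · rw [← hw, sChain_mul_p, h.apply_sChain_cons hc hc1 hβ hl]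
    · rw [sChain_mul_p_of_ne hw, map_zero]
  intro w l w' l' hl hl'
  induction l generalizing w w' l' with
  | nil =>
    cases l' with
    | nil =>
      rw [sChain, sChain, star_p]
      by_cases hw : w = w'
      · subst hw
        simp [DirGraph.chainSrc, p_mul_p_self]
      · rw [(isCKFamily E).proj_orthogonal _ _ hw, map_zero, if_neg fun h => hw h.1]
    | cons f l' =>
      -- The value at p_w s_ν^* is the conjugate of the value at s_ν p_w, which `hnil` makes zero.
      rw [if_neg (by simp), ← star_star (sChain E w []), ← star_mul, map_star_of_positive hφ,
        sChain, star_p, hnil w hl', star_zero]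
  | cons e l ih =>
    cases l' with
    | nil =>
      rw [if_neg (by simp), sChain.eq_1 E w', star_p, hnil w' hl]
    | cons f l' =>
      -- Rotating s_e to the right end puts it next to s_ν^*, where it cancels the first edge of ν
      -- or gives zero.
      rw [sChain, mul_assoc, h.edge, mul_assoc]
      by_cases hef : e = f
      · subst hef
        rw [← star_star (s E e), ← star_mul, star_s_mul_sChain_cons hl', ih _ _ _ hl.2 hl'.2]
        have hw : w = w' := hl.1.symm.trans hl'.1
        rw [mul_ite, mul_zero, ← mul_assoc, ← prod_map_cons_rpow hc]
        exact if_congr ⟨fun h => ⟨hw, by rw [h.2]⟩, fun h => ⟨rfl, (List.cons.inj h.2).2⟩⟩ rfl rfl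
      · rw [← star_star (s E e), ← star_mul, star_s_mul_sChain_cons_of_ne hef, star_zero, mul_zero,
          map_zero, mul_zero, if_neg (by simp [hef])]

/-- Both sides are continuous and linear in y, so y = s_μ s_ν^* suffices. In the edge relation
either side can be nonzero only when ν = eμ. -/
theorem IsDiagonal.isTwistedTrace (h : IsDiagonal c β φ) (hc : ∀ e, 0 < c e) :
    IsTwistedTrace c β φ where
  vertex v y := by
    suffices H : φ ∘L ContinuousLinearMap.mul ℂ _ (p E v) =
        φ ∘L (ContinuousLinearMap.mul ℂ _).flip (p E v) from DFunLike.congr_fun H y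
    refine functional_ext fun w l w' l' hl hl' => ?_
    show φ (p E v * (sChain E w l * star (sChain E w' l'))) =
      φ (sChain E w l * star (sChain E w' l') * p E v)
    have hr : star (sChain E w' l') * p E v = star (p E v * sChain E w' l') := by
      rw [star_mul, star_p]
    rw [← mul_assoc, mul_assoc _ _ (p E v), hr]
    have hd := h w l w' l' hl hl'
    by_cases hv : v = w <;> by_cases hv' : v = w'
    · subst hv hv'
      rw [p_mul_sChain hl, p_mul_sChain hl']
    · rw [p_mul_sChain_of_ne hl' hv', hv, p_mul_sChain hl, hd, if_neg fun h => hv' (hv.trans h.1)]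
      simp
    · rw [p_mul_sChain_of_ne hl hv, hv', p_mul_sChain hl', hd,
        if_neg fun h => hv (hv'.trans h.1.symm)]
      simp
    · rw [p_mul_sChain_of_ne hl hv, p_mul_sChain_of_ne hl' hv']
      simp
  edge e y := by
    classical
    suffices H : φ ∘L ContinuousLinearMap.mul ℂ _ (s E e) =
        ((c e ^ (-β) : ℝ) : ℂ) • φ ∘L (ContinuousLinearMap.mul ℂ _).flip (s E e) from
      DFunLike.congr_fun H y
    refine functional_ext fun w l w' l' hl hl' => ?_
    show φ (s E e * (sChain E w l * star (sChain E w' l'))) =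
      ((c e ^ (-β) : ℝ) : ℂ) * φ (sChain E w l * star (sChain E w' l') * s E e)
    have hleft : φ (s E e * (sChain E w l * star (sChain E w' l'))) =
        if l' = e :: l ∧ E.src e = w then
          ((((e :: l).map c).prod ^ (-β) : ℝ) : ℂ) * φ (p E (E.chainSrc w l)) else 0 := by
      rw [← mul_assoc]
      by_cases hw : E.src e = w
      · subst hw
        have := h (E.rng e) (e :: l) w' l' ⟨rfl, hl⟩ hl'
        rw [sChain] at this
        rw [this]
        refine if_congr ⟨fun h => ⟨h.2.symm, rfl⟩, fun h => ⟨?_, h.1.symm⟩⟩ rfl rfl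
        rw [h.1] at hl'
        exact hl'.1
      · rw [s_mul_sChain_of_ne hl hw, zero_mul, map_zero, if_neg fun h => hw h.2]
    rw [hleft, mul_assoc]
    cases l' with
    | nil =>
      rw [if_neg (by simp), sChain.eq_1 E w', star_p]
      by_cases hw : E.rng e = w'
      · rw [← hw, p_mul_s]
        by_cases he : E.chainSrc w l = E.rng e
        · obtain ⟨h1, h2⟩ := sChain_mul_s hl he
          -- When ν is a vertex the right side is φ(s_{μe}). Writing s_{μe} as s_{μe} p_{s(e)}^*
          -- lets the diagonal formula apply, and it gives zero.
          have := h w (l ++ [e]) (E.chainSrc w (l ++ [e])) [] h1 trivial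
          rw [sChain.eq_1 E (E.chainSrc _ _), star_p, sChain_mul_p, if_neg (by simp)] at this
          rw [← h2, this, mul_zero]
        · rw [sChain_mul_s_of_ne he, map_zero, mul_zero]
      · rw [p_mul_s_of_ne E hw, mul_zero, map_zero, mul_zero]
    | cons f l' =>
      by_cases hef : e = f
      · subst hef
        have hs : star (sChain E w' (e :: l')) * s E e = star (sChain E (E.src e) l') := by
          rw [← star_star (s E e), ← star_mul, star_s_mul_sChain_cons hl']
        rw [hs, h _ _ _ _ hl hl'.2, prod_map_cons_rpow hc, mul_ite, mul_zero, mul_assoc]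
        exact if_congr ⟨fun h => ⟨h.2.symm, (List.cons.inj h.1).2.symm⟩,
          fun h => ⟨by rw [h.2], h.1.symm⟩⟩ rfl rfl
      · have hs : star (sChain E w' (f :: l')) * s E e = 0 := by
          rw [← star_star (s E e), ← star_mul, star_s_mul_sChain_cons_of_ne hef, star_zero]
        rw [hs, mul_zero, map_zero, mul_zero, if_neg fun h => hef (List.cons.inj h.1).1.symm]

/-! ### Eigenvectors of the dynamics -/

theorem isAnalyticExtension_of_eigenvector {x : GraphCStar E} {r : ℝ}
    (h : ∀ t, dynamics E c t x = Complex.exp (Complex.I * t * r) • x) :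
    IsAnalyticExtension (dynamics E c) x fun ζ => Complex.exp (Complex.I * ζ * r) • x :=
  ⟨by fun_prop, fun t => (h t).symm⟩

theorem dynamics_sChain (hc : ∀ e, 0 < c e) (t : ℝ) (w : V) (l : List Ed) :
    dynamics E c t (sChain E w l) =
      Complex.exp (Complex.I * t * Real.log (l.map c).prod) • sChain E w l := by
  induction l generalizing w with
  | nil => simp [sChain, dynamics_p]
  | cons e l ih =>
    rw [sChain, map_mul, ih, dynamics, act_s, smul_mul_smul_comm, Circle.coe_exp, ← Complex.exp_add,
      List.map_cons, List.prod_cons, Real.log_mul (hc e).ne' (prod_map_pos hc l).ne']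
    congr 2
    push_cast
    ring

theorem dynamics_sChain_mul_star (hc : ∀ e, 0 < c e) (t : ℝ) (w w' : V) (l l' : List Ed) :
    dynamics E c t (sChain E w l * star (sChain E w' l')) =
      Complex.exp (Complex.I * t *
        (Real.log (l.map c).prod - Real.log (l'.map c).prod : ℝ)) •
          (sChain E w l * star (sChain E w' l')) := by
  rw [map_mul, map_star, dynamics_sChain hc, dynamics_sChain hc, star_smul, smul_mul_smul_comm,
    Complex.star_def, ← Complex.exp_conj, ← Complex.exp_add]
  congr 2
  simp only [map_mul, Complex.conj_I, Complex.conj_ofReal]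
  push_cast
  ring

theorem exp_I_mul_I_mul_log {x : ℝ} (hx : 0 < x) (β : ℝ) :
    Complex.exp (Complex.I * (Complex.I * β) * Real.log x) = ((x ^ (-β) : ℝ) : ℂ) := by
  rw [Real.rpow_def_of_pos hx, Complex.ofReal_exp, ← mul_assoc, Complex.I_mul_I]
  congr 1
  push_cast
  ring

/-! ### KMS functionals and twisted traces -/

theorem IsKMSState.isTwistedTrace (h : IsKMSState (dynamics E c) β φ) (hc : ∀ e, 0 < c e) :
    IsTwistedTrace c β φ where
  vertex v y := by
    suffices H : φ ∘L ContinuousLinearMap.mul ℂ _ (p E v) =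
        φ ∘L (ContinuousLinearMap.mul ℂ _).flip (p E v) from DFunLike.congr_fun H y
    refine functional_ext fun w l w' l' _ _ => ?_
    exact h.2 _ _ _ _ ⟨differentiable_const _, fun t => (dynamics_p E c t v).symm⟩
      (isAnalyticExtension_of_eigenvector fun t => dynamics_sChain_mul_star hc t w w' l l')
  edge e y := by
    suffices H : φ ∘L ContinuousLinearMap.mul ℂ _ (s E e) =
        ((c e ^ (-β) : ℝ) : ℂ) • φ ∘L (ContinuousLinearMap.mul ℂ _).flip (s E e) from
      DFunLike.congr_fun H y
    refine functional_ext fun w l w' l' _ _ => ?_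
    have := h.2 _ _ _ _
      (isAnalyticExtension_of_eigenvector (x := s E e) (r := Real.log (c e)) fun t => by
        have := dynamics_sChain (E := E) hc t (E.rng e) [e]
        simpa [sChain, s_mul_p] using this)
      (isAnalyticExtension_of_eigenvector fun t => dynamics_sChain_mul_star hc t w w' l l')
    rw [exp_I_mul_I_mul_log (hc e), mul_smul_comm, map_smul, smul_eq_mul] at this
    exact this

/-- The only s_μ s_ν^* on which φ can be nonzero are the s_μ s_μ^*, and these are fixed by the
dynamics. -/
theorem IsDiagonal.apply_dynamics (h : IsDiagonal c β φ) (hc : ∀ e, 0 < c e) (t : ℝ)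
    (a : GraphCStar E) : φ (dynamics E c t a) = φ a := by
  let L : GraphCStar E →L[ℂ] GraphCStar E :=
    ⟨(dynamics E c t : GraphCStar E →ₗ[ℂ] GraphCStar E), map_continuous (dynamics E c t)⟩
  suffices H : φ ∘L L = φ from DFunLike.congr_fun H a
  refine functional_ext fun w l w' l' hl hl' => ?_
  show φ (dynamics E c t _) = _
  rw [dynamics_sChain_mul_star hc, map_smul, h w l w' l' hl hl']
  split_ifs with hw
  · simp [hw.2]
  · simp

theorem IsTwistedTrace.mul_star_sChain (h : IsTwistedTrace c β φ)
    (hφ : ∀ a, 0 ≤ φ (star a * a)) (hc : ∀ e, 0 < c e) (w : V) (l : List Ed) (y : GraphCStar E) :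
    φ (y * star (sChain E w l)) =
      (((l.map c).prod ^ (-β) : ℝ) : ℂ) * φ (star (sChain E w l) * y) := by
  have h1 := h.sChain_mul hc w l (star y)
  rw [← star_star (sChain E w l), ← star_mul, ← star_mul, map_star_of_positive hφ,
    map_star_of_positive hφ] at h1
  have h2 := congrArg star h1
  rw [star_star, star_mul', star_star, Complex.star_def, Complex.conj_ofReal] at h2
  exact h2

/-- Both sides are multiples of φ(s_ν^* x s_μ): moving s_ν^* to the front costs c(ν)^{-β}, and
putting s_μ before it costs c(μ)^β. -/
theorem IsTwistedTrace.mul_sChain_mul_star (h : IsTwistedTrace c β φ)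
    (hφ : ∀ a, 0 ≤ φ (star a * a)) (hc : ∀ e, 0 < c e) (w w' : V) (l l' : List Ed)
    (x : GraphCStar E) :
    φ (x * (sChain E w l * star (sChain E w' l'))) =
      (((l.map c).prod ^ β * (l'.map c).prod ^ (-β) : ℝ) : ℂ) *
        φ (sChain E w l * star (sChain E w' l') * x) := by
  have h0 : (((l.map c).prod ^ β : ℝ) : ℂ) * (((l.map c).prod ^ (-β) : ℝ) : ℂ) = 1 := by
    rw [← Complex.ofReal_mul, ← Real.rpow_add (prod_map_pos hc l), add_neg_cancel, Real.rpow_zero,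
      Complex.ofReal_one]
  rw [← mul_assoc, h.mul_star_sChain hφ hc, mul_assoc (sChain E w l), h.sChain_mul hc, mul_assoc,
    Complex.ofReal_mul]
  linear_combination (-(((l'.map c).prod ^ (-β) : ℝ) : ℂ) *
    φ (star (sChain E w' l') * (x * sChain E w l))) * h0

/-- An entire function is determined by its values on the real line. -/
theorem entire_ext {f g : ℂ → ℂ} (hf : Differentiable ℂ f) (hg : Differentiable ℂ g)
    (h : ∀ t : ℝ, f t = g t) : f = g := by
  refine AnalyticOnNhd.eq_of_frequently_eq (z₀ := 0)
    (hf.differentiableOn.analyticOnNhd isOpen_univ) (hg.differentiableOn.analyticOnNhd isOpen_univ)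
    ?_
  have ht : Tendsto (fun t : ℝ => (t : ℂ)) (𝓝[≠] 0) (𝓝[≠] 0) := by
    refine tendsto_nhdsWithin_iff.2 ⟨?_, ?_⟩
    · exact (Complex.continuous_ofReal.tendsto' 0 0 Complex.ofReal_zero).mono_left
        nhdsWithin_le_nhds
    · filter_upwards [self_mem_nhdsWithin] with t ht
      exact Complex.ofReal_ne_zero.2 ht
  exact ht.frequently (Eventually.of_forall h).frequently

theorem IsDiagonal.isKMSState (h : IsDiagonal c β φ) (hφ : IsState φ) (hc : ∀ e, 0 < c e) :
    IsKMSState (dynamics E c) β φ := by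
  refine ⟨hφ, fun x y f g hf _ => ?_⟩
  suffices H : φ ∘L ContinuousLinearMap.mul ℂ _ x =
      φ ∘L (ContinuousLinearMap.mul ℂ _).flip (f (Complex.I * β)) from DFunLike.congr_fun H y
  refine functional_ext fun w l w' l' _ _ => ?_
  set y := sChain E w l * star (sChain E w' l') with hy
  set r : ℝ := Real.log (l.map c).prod - Real.log (l'.map c).prod with hr
  show φ (x * y) = φ (y * f (Complex.I * β))
  -- For real t, y is an eigenvector, so y σ_t(x) is a scalar times σ_t(yx), and φ is invariant.
  -- Both sides are entire in t; at t = iβ the scalar is c(μ)^β c(ν)^{-β}.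
  have hreal : ∀ t : ℝ, φ (y * f t) = Complex.exp (-(Complex.I * t * r)) * φ (y * x) := fun t => by
    have h1 : y * f t =
        Complex.exp (-(Complex.I * t * r)) • dynamics E c t (y * x) := by
      rw [hf.2, map_mul, hy, dynamics_sChain_mul_star hc, ← hr, smul_mul_assoc, smul_smul,
        ← Complex.exp_add, neg_add_cancel, Complex.exp_zero, one_smul]
    rw [h1, map_smul, h.apply_dynamics hc, smul_eq_mul]
  have hent := entire_ext (f := fun ζ => φ (y * f ζ))
    (g := fun ζ => Complex.exp (-(Complex.I * ζ * r)) * φ (y * x))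
    ((φ ∘L ContinuousLinearMap.mul ℂ _ y).differentiable.comp hf.1) (by fun_prop) hreal
  have h1 := congrFun hent (Complex.I * β)
  beta_reduce at h1
  rw [h1, (h.isTwistedTrace hc).mul_sChain_mul_star hφ.1 hc]
  congr 1
  rw [Complex.ofReal_mul, ← neg_neg β, ← exp_I_mul_I_mul_log (prod_map_pos hc l), neg_neg,
    ← exp_I_mul_I_mul_log (prod_map_pos hc l'), ← Complex.exp_add]
  congr 1
  rw [hr]
  push_cast
  ring

/-! ### Diagonal functionals and states on the core -/

theorem IsDiagonal.comp_coreIncl_mem (h : IsDiagonal c β φ) (hφ : IsState φ) :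
    φ ∘L coreIncl E ∈ CoreStates E c β := by
  classical
  refine ⟨hφ.comp_coreIncl, fun μ ν _ _ => ?_⟩
  refine (h _ _ _ _ μ.chain ν.chain).trans (if_congr ?_ rfl rfl)
  exact DirGraph.Path.ext_iff.symm

/-- The cases outside (*) are automatic: Φ kills unequal lengths, and s_μ s_ν^* = 0 when the sources
differ. -/
theorem isDiagonal_of_mem_coreStates {ω : core E →L[ℂ] ℂ} (hω : ω ∈ CoreStates E c β) :
    IsDiagonal c β (ω ∘L coreExp E) := by
  classical
  intro w l w' l' hl hl'
  by_cases hlen : l.length = l'.length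
  · have h1 : (ω ∘L coreExp E) (sChain E w l * star (sChain E w' l')) =
        ω (coreElem ⟨w, l, hl⟩ ⟨w', l', hl'⟩ hlen) := 
      congrArg ω (coreExp_coe (coreElem ⟨w, l, hl⟩ ⟨w', l', hl'⟩ hlen))
    by_cases hsrc : E.chainSrc w l = E.chainSrc w' l'
    · rw [h1, hω.2 ⟨w, l, hl⟩ ⟨w', l', hl'⟩ hlen hsrc]
      have h2 : (ω ∘L coreExp E) (p E (E.chainSrc w l)) = ω (coreProj (E.chainSrc w l)) :=
        congrArg ω (coreExp_coe (coreProj _))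
      rw [h2]
      exact if_congr DirGraph.Path.ext_iff rfl rfl
    · rw [if_neg fun h => hsrc (by rw [h.1, h.2]), ← p_mul_star_sChain, ← mul_assoc,
        sChain_mul_p_of_ne hsrc, zero_mul, map_zero]
  · have h1 : coreExp E (sChain E w l * star (sChain E w' l')) = 0 :=
      Subtype.ext ((coreExp_sPath ⟨w, l, hl⟩ ⟨w', l', hl'⟩).trans (if_neg hlen))
    rw [if_neg fun h => hlen (by rw [h.2])]
    show ω (coreExp E _) = 0
    rw [h1, map_zero]

/-- Φ changes only the s_μ s_ν^* with |μ| ≠ |ν|, and there φ already vanishes. -/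
theorem IsDiagonal.comp_coreIncl_comp_coreExp (h : IsDiagonal c β φ) :
    (φ ∘L coreIncl E) ∘L coreExp E = φ := by
  refine functional_ext fun w l w' l' hl hl' => ?_
  have h1 := coreExp_sPath ⟨w, l, hl⟩ ⟨w', l', hl'⟩
  show φ (coreExp E _ : core E) = _
  refine (congrArg φ h1).trans ?_
  split_ifs with hlen
  · rfl
  · rw [map_zero, h w l w' l' hl hl', if_neg fun h => hlen (congrArg List.length h.2)]

theorem IsDiagonal.convex {ψ : GraphCStar E →L[ℂ] ℂ} (hφ : IsDiagonal c β φ)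
    (hψ : IsDiagonal c β ψ) (a b : ℂ) : IsDiagonal c β (a • φ + b • ψ) := by
  intro w l w' l' hl hl'
  simp only [add_apply, smul_apply, smul_eq_mul, hφ w l w' l' hl hl', hψ w l w' l' hl hl']
  split_ifs <;> ring

theorem comp_coreExp_comp_coreIncl (ω : core E →L[ℂ] ℂ) :
    (ω ∘L coreExp E) ∘L coreIncl E = ω := by
  ext a
  exact congrArg ω (coreExp_coe a)

end GraphAlg

/-! ### The correspondence between KMS states and core states -/

open GraphAlg in
theorem mainTheorem1 {V : Type u} {Ed : Type v} (E : DirGraph V Ed) (c : Ed → ℝ)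
    (hc : ∀ e, 0 < c e) (hc1 : ∀ μ : E.Path, 0 < μ.length → μ.weight c ≠ 1)
    (β : ℝ) (hβ : 0 < β) :
    (∀ φ ∈ KMSStates E c β, φ ∘L coreIncl E ∈ CoreStates E c β) ∧
    (∀ ω ∈ CoreStates E c β, ω ∘L coreExp E ∈ KMSStates E c β) ∧
    (∀ φ ∈ KMSStates E c β, (φ ∘L coreIncl E) ∘L coreExp E = φ) ∧
    (∀ ω ∈ CoreStates E c β, (ω ∘L coreExp E) ∘L coreIncl E = ω) ∧
    (∀ (a b : ℝ), 0 ≤ a → 0 ≤ b → a + b = 1 →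
      (∀ φ₁ ∈ KMSStates E c β, ∀ φ₂ ∈ KMSStates E c β,
        (a : ℂ) • φ₁ + (b : ℂ) • φ₂ ∈ KMSStates E c β ∧
        ((a : ℂ) • φ₁ + (b : ℂ) • φ₂) ∘L coreIncl E =
          (a : ℂ) • (φ₁ ∘L coreIncl E) + (b : ℂ) • (φ₂ ∘L coreIncl E)) ∧
      (∀ ω₁ ∈ CoreStates E c β, ∀ ω₂ ∈ CoreStates E c β,
        (a : ℂ) • ω₁ + (b : ℂ) • ω₂ ∈ CoreStates E c β ∧
        ((a : ℂ) • ω₁ + (b : ℂ) • ω₂) ∘L coreExp E =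
          (a : ℂ) • (ω₁ ∘L coreExp E) + (b : ℂ) • (ω₂ ∘L coreExp E))) := by
  have hdiag : ∀ φ ∈ KMSStates E c β, IsDiagonal c β φ := fun φ hφ =>
    (IsKMSState.isTwistedTrace hφ hc).isDiagonal hφ.1.1 hc hc1 hβ
  refine ⟨fun φ hφ => (hdiag φ hφ).comp_coreIncl_mem hφ.1,
    fun ω hω => (isDiagonal_of_mem_coreStates hω).isKMSState hω.1.comp_coreExp hc,
    fun φ hφ => (hdiag φ hφ).comp_coreIncl_comp_coreExp,
    fun ω _ => comp_coreExp_comp_coreIncl ω, fun a b ha hb hab => ⟨fun φ₁ h₁ φ₂ h₂ => ⟨?_, rfl⟩,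
      fun ω₁ h₁ ω₂ h₂ => ⟨⟨?_, fun μ ν h hs => ?_⟩, rfl⟩⟩⟩
  · exact ((hdiag φ₁ h₁).convex (hdiag φ₂ h₂) a b).isKMSState
      (h₁.1.convex h₂.1 (isStarProjection_vertexSum E) (tendsto_vertexSum_mul E) ha hb hab) hc
  · exact h₁.1.convex h₂.1 (isStarProjection_coreVertexSum E) (tendsto_coreVertexSum_mul E)
      ha hb hab
  · show (a : ℂ) * ω₁ _ + (b : ℂ) * ω₂ _ = _
    rw [h₁.2 μ ν h hs, h₂.2 μ ν h hs]
    split_ifs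
    · show _ = _ * ((a : ℂ) * ω₁ _ + (b : ℂ) * ω₂ _)
      ring
    · ring
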